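/- Let $R$ be a Noetherian commutative ring with unity of prime characteristic $p>0$, and let $R^\circ$ be the set of elements of $R$ contained in no minimal prime ideal. For an ideal $I$ and $q=p^e$ ($e\ge 0$), let $I^{[q]}$ be the ideal generated by the $q$-th powers of all elements of $I$. Let $I^F=\{x\in R : x^q\in I^{[q]} \text{ for some } q=p^e\}$ be the Frobenius closure of $I$, and let $I^*=\{x\in R : \exists\, c\in R^\circ \text{ with } cx^q\in I^{[q]} \text{ for all large } q=p^e\}$ be its tight closure. Write ${}^e\!R$ for $R$ viewed as an $R$-module via the $e$-times iterated Frobenius map. The ring $R$ is F-pure if $M\to {}^1\!R\otimes_R M$, $z\mapsto 1\otimes z$, is injective for every $R$-module $M$. For an $R$-module $M$, let $0^*_M$ be the submodule of all $z\in M$ for which there is $c\in R^\circ$ with $c\otimes z=0$ in ${}^e\!R\otimes_R M$ for all large $e$. The test ideal is $\tau(R)=\bigcap_M \mathrm{Ann}_R(0^*_M)$, where $M$ runs over all finitely generated $R$-modules. Let $\mathfrak a$ be a proper ideal of $R$ with $\mathfrak a\cap R^\circ\neq\emptyset$. For an ideal $J$ with $\mathfrak a\subseteq\sqrt J$ and for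 $q=p^e$, put $$\nu^J_{\mathfrak a}(q)=\max\{r\in\mathbb N : \mathfrak a^r\not\subseteq J^{[q]}\}$$ (with value $0$ if $\mathfrak a\subseteq J^{[q]}$), and $$c_+^J(\mathfrak a)=\limsup_{q=p^e\to\infty}\frac{\nu^J_{\mathfrak a}(q)}{q},\qquad c_-^J(\mathfrak a)=\liminf_{q=p^e\to\infty}\frac{\nu^J_{\mathfrak a}(q)}{q}.$$ We say that the F-threshold $c^J(\mathfrak a)$ exists if $c_+^J(\mathfrak a)=c_-^J(\mathfrak a)$ is a (finite) real number, and $c^J(\mathfrak a)$ then denotes this common value. Let $J$ be an ideal of $R$ with $\mathfrak a\subseteq\sqrt J$. 1. If $J^{[q]}=(J^{[q]})^F$ for all large $q=p^e$, then $c^J(\mathfrak a)$ exists. In particular, if $R$ is F-pure, then $c^J(\mathfrak a)$ exists. 2. If $\mathfrak a\subseteq\sqrt{\tau(R)}$, then $c^J(\mathfrak a)$ and $c^{J^*}(\mathfrak a)$ exist and $c^J(\mathfrak a)=c^{J^*}(\mathfrak a)$. 3. If $\mathfrak a$ is principal, then $c^J(\mathfrak a)$ exists. -/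

import Mathlib

open scoped TensorProduct NNReal ENNReal

universe u v

namespace FThreshold

/-- `R°`: the elements of `R` that lie in no minimal prime ideal. -/
def circ (R : Type u) [CommRing R] : Set R :=
  {c | ∀ P ∈ minimalPrimes R, c ∉ P}

theorem one_mem_circ (R : Type u) [CommRing R] : (1 : R) ∈ circ R :=
  fun P hP h1 => hP.1.1.ne_top ((Ideal.eq_top_iff_one P).2 h1)

theorem mul_mem_circ {R : Type u} [CommRing R] {c d : R} (hc : c ∈ circ R) (hd : d ∈ circ R) :
    c * d ∈ circ R := by
  intro P hP h
  rcases hP.1.1.mem_or_mem h with h | h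
  · exact hc P hP h
  · exact hd P hP h

/-- `I^{[q]}`: the ideal generated by the `q`-th powers of all elements of `I`. -/
def frobPow {R : Type u} [CommRing R] (I : Ideal R) (q : ℕ) : Ideal R :=
  Ideal.span ((fun x : R => x ^ q) '' (I : Set R))

theorem pow_mem_frobPow {R : Type u} [CommRing R] (p : ℕ) [Fact p.Prime] [CharP R p]
    {I : Ideal R} {x : R} {e e' : ℕ} (h : e ≤ e') (hx : x ^ p ^ e ∈ frobPow I (p ^ e)) :
    x ^ p ^ e' ∈ frobPow I (p ^ e') := by
  obtain ⟨k, rfl⟩ := Nat.exists_eq_add_of_le h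
  have h1 : frobPow I (p ^ e) ≤ (frobPow I (p ^ (e + k))).comap (iterateFrobenius R p k) := by
    refine Ideal.span_le.2 ?_
    rintro _ ⟨y, hy, rfl⟩
    change iterateFrobenius R p k (y ^ p ^ e) ∈ frobPow I (p ^ (e + k))
    rw [iterateFrobenius_def, ← pow_mul, ← pow_add]
    exact Ideal.subset_span ⟨y, hy, rfl⟩
  have h2 := h1 hx
  rwa [Ideal.mem_comap, iterateFrobenius_def, ← pow_mul, ← pow_add] at h2

/-- The Frobenius closure `I^F`: all `x` with `x^q ∈ I^{[q]}` for some `q = p^e`. -/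
def frobClosure {R : Type u} [CommRing R] (p : ℕ) [Fact p.Prime] [CharP R p] (I : Ideal R) :
    Ideal R where
  carrier := {x | ∃ e : ℕ, x ^ p ^ e ∈ frobPow I (p ^ e)}
  add_mem' := by
    rintro x y ⟨e, hx⟩ ⟨e', hy⟩
    refine ⟨max e e', ?_⟩
    rw [add_pow_char_pow]
    exact Ideal.add_mem _ (pow_mem_frobPow p (le_max_left _ _) hx)
      (pow_mem_frobPow p (le_max_right _ _) hy)
  zero_mem' := ⟨0, by simp⟩
  smul_mem' := by
    rintro a x ⟨e, hx⟩
    refine ⟨e, ?_⟩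
    rw [smul_eq_mul, mul_pow]
    exact Ideal.mul_mem_left _ _ hx

/-- The tight closure `I^*` of an ideal: all `x` for which there is `c ∈ R°` with
`c x^q ∈ I^{[q]}` for all large `q = p^e`. -/
def tightClosure {R : Type u} [CommRing R] (p : ℕ) [Fact p.Prime] [CharP R p] (I : Ideal R) :
    Ideal R where
  carrier := {x | ∃ c ∈ circ R, ∃ e₀ : ℕ, ∀ e ≥ e₀, c * x ^ p ^ e ∈ frobPow I (p ^ e)}
  add_mem' := by
    rintro x y ⟨c, hc, e, hx⟩ ⟨d, hd, e', hy⟩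
    refine ⟨c * d, mul_mem_circ hc hd, max e e', fun n hn => ?_⟩
    rw [add_pow_char_pow]
    have h1 := Ideal.mul_mem_left _ d (hx n (le_trans (le_max_left _ _) hn))
    have h2 := Ideal.mul_mem_left _ c (hy n (le_trans (le_max_right _ _) hn))
    convert Ideal.add_mem _ h1 h2 using 1
    ring
  zero_mem' := ⟨1, one_mem_circ R, 0, fun e _ => by
    simp [zero_pow (pow_ne_zero e (Fact.out : p.Prime).ne_zero)]⟩
  smul_mem' := by
    rintro a x ⟨c, hc, e, hx⟩
    refine ⟨c, hc, e, fun n hn => ?_⟩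
    have h1 := Ideal.mul_mem_left _ (a ^ p ^ n) (hx n hn)
    convert h1 using 1
    rw [smul_eq_mul]
    ring

/-- `ᵉR`: the ring `R`, regarded as an `R`-algebra through the `e`-times iterated
Frobenius map. -/
def FrobRing (R : Type u) (_p _e : ℕ) : Type u := R

instance (R : Type u) [CommRing R] (p e : ℕ) : CommRing (FrobRing R p e) :=
  inferInstanceAs (CommRing R)

/-- The identity map from `R` to `ᵉR`; it is a ring isomorphism but not `R`-linear. -/
def FrobRing.of (R : Type u) [CommRing R] (p e : ℕ) : R ≃+* FrobRing R p e :=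
  RingEquiv.refl R

instance (R : Type u) [CommRing R] (p e : ℕ) [Fact p.Prime] [CharP R p] :
    Algebra R (FrobRing R p e) :=
  ((FrobRing.of R p e).toRingHom.comp (iterateFrobenius R p e)).toAlgebra

/-- The Frobenius functor `𝔽ᵉ(M) = ᵉR ⊗_R M`. It is a module over `ᵉR` through the left factor
(this is how `c` multiplies `z^q` below). -/
abbrev FrobFunctor (R : Type u) [CommRing R] (p e : ℕ) [Fact p.Prime] [CharP R p]
    (M : Type v) [AddCommGroup M] [Module R M] : Type (max u v) :=
  FrobRing R p e ⊗[R] M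

/-- The map `M → 𝔽ᵉ(M)`, `z ↦ z^q = 1 ⊗ z`, where `q = p^e`. -/
def frobMap (R : Type u) [CommRing R] (p e : ℕ) [Fact p.Prime] [CharP R p]
    (M : Type v) [AddCommGroup M] [Module R M] : M →ₗ[R] FrobFunctor R p e M :=
  TensorProduct.mk R (FrobRing R p e) M 1

/-- `R` is F-pure: for every `R`-module `M` the map `M → ¹R ⊗_R M` is injective. -/
def IsFPure (R : Type u) [CommRing R] (p : ℕ) [Fact p.Prime] [CharP R p] : Prop :=
  ∀ (M : Type u) [AddCommGroup M] [Module R M], Function.Injective (frobMap R p 1 M)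

/-- `N^{[q]}_M`, for `q = p^e`: the image of `𝔽ᵉ(N) → 𝔽ᵉ(M)`. -/
def frobPowModule {R : Type u} [CommRing R] (p e : ℕ) [Fact p.Prime] [CharP R p]
    {M : Type v} [AddCommGroup M] [Module R M] (N : Submodule R M) :
    Submodule (FrobRing R p e) (FrobFunctor R p e M) :=
  LinearMap.range (N.subtype.baseChange (FrobRing R p e))

/-- The tight closure `N^*_M` of `N` in `M`: all `z ∈ M` for which there is `c ∈ R°` with
`c z^q ∈ N^{[q]}_M` for all large `q = p^e`. -/
def tightClosureModule {R : Type u} [CommRing R] (p : ℕ) [Fact p.Prime] [CharP R p]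
    {M : Type v} [AddCommGroup M] [Module R M] (N : Submodule R M) : Submodule R M where
  carrier := {z | ∃ c ∈ circ R, ∃ e₀ : ℕ, ∀ e ≥ e₀,
    FrobRing.of R p e c • frobMap R p e M z ∈ frobPowModule p e N}
  add_mem' := by
    rintro x y ⟨c, hc, e, hx⟩ ⟨d, hd, e', hy⟩
    refine ⟨c * d, mul_mem_circ hc hd, max e e', fun n hn => ?_⟩
    have h1 := Submodule.smul_mem _ (FrobRing.of R p n d) (hx n (le_trans (le_max_left _ _) hn))
    have h2 := Submodule.smul_mem _ (FrobRing.of R p n c) (hy n (le_trans (le_max_right _ _) hn))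
    rw [smul_smul, mul_comm, ← map_mul] at h1
    rw [smul_smul, ← map_mul] at h2
    rw [map_add, smul_add]
    exact Submodule.add_mem _ h1 h2
  zero_mem' := ⟨1, one_mem_circ R, 0, fun e _ => by
    rw [map_zero, smul_zero]; exact Submodule.zero_mem _⟩
  smul_mem' := by
    rintro a x ⟨c, hc, e, hx⟩
    refine ⟨c, hc, e, fun n hn => ?_⟩
    rw [map_smul, ← algebraMap_smul (FrobRing R p n) a (frobMap R p n M x), smul_comm]
    exact Submodule.smul_mem _ _ (hx n hn)

/-- The test ideal `τ(R)`: the intersection of the annihilators of `0^*_M` over all finitely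
generated `R`-modules `M`. -/
def testIdeal (R : Type u) [CommRing R] (p : ℕ) [Fact p.Prime] [CharP R p] : Ideal R :=
  ⨅ (M : Type u) (_ : AddCommGroup M) (_ : Module R M) (_ : Module.Finite R M),
    (tightClosureModule p (⊥ : Submodule R M)).annihilator

/-- `ν_a^J(q)`: the largest `r` with `a^r ⊄ J^{[q]}`, and `0` if there is no such `r`.
(The set is bounded when `R` is Noetherian and `a` lies in the radical of `J`.) -/
noncomputable def nu {R : Type u} [CommRing R] (a J : Ideal R) (q : ℕ) : ℕ :=
  sSup {r : ℕ | ¬ a ^ r ≤ frobPow J q}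

/-- The limit superior of `ν_a^J(q) / q` as `q = p^e` tends to infinity. -/
noncomputable def fThresholdPlus {R : Type u} [CommRing R] (p : ℕ) (a J : Ideal R) : ℝ≥0∞ :=
  Filter.limsup (fun e : ℕ => (nu a J (p ^ e) : ℝ≥0∞) / ((p ^ e : ℕ) : ℝ≥0∞)) Filter.atTop

/-- The limit inferior of `ν_a^J(q) / q` as `q = p^e` tends to infinity. -/
noncomputable def fThresholdMinus {R : Type u} [CommRing R] (p : ℕ) (a J : Ideal R) : ℝ≥0∞ :=
  Filter.liminf (fun e : ℕ => (nu a J (p ^ e) : ℝ≥0∞) / ((p ^ e : ℕ) : ℝ≥0∞)) Filter.atTop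

/-- The F-threshold of `a` with respect to `J` exists and equals the (finite, nonnegative) real
number `c`: the limit superior and the limit inferior both equal `c`. -/
def HasFThreshold {R : Type u} [CommRing R] (p : ℕ) (a J : Ideal R) (c : ℝ≥0) : Prop :=
  fThresholdPlus p a J = (c : ℝ≥0∞) ∧ fThresholdMinus p a J = (c : ℝ≥0∞)

end FThreshold

namespace FThreshold

open Filter Topology

/-! ### Frobenius powers, closures and the test ideal -/

section Algebra

variable {R : Type u} [CommRing R] (p : ℕ) [Fact p.Prime] [CharP R p]

/-! Write ν(q) for `nu a J q`. Noetherianity gives ν(q) ≤ Bq with B independent of q, so convergence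
of ν(q)/q follows once a small correction makes it monotone.

Suppose a^d multiplies (J^{[q]})^F into J^{[q]} for large q. If a^{p(ν(q)-d)} lay in J^{[pq]}, every
x in a^{ν(q)-d} would satisfy x^p ∈ (J^{[q]})^{[p]}, hence x ∈ (J^{[q]})^F, and a^{ν(q)} would lie
in J^{[q]}. So p(ν(q)-d) ≤ ν(pq), and (ν(q)-2d)/q eventually increases. Frobenius closed J^{[q]}, in
particular F-purity, gives d = 0. If a^d ⊆ τ(R), the same d works because τ(R) multiplies I^* into I
and I^F ⊆ I^*; it also keeps the ν of J and of J^* within d+1 of each other.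

For principal a = (f), raising f^{ν(q)+1} ∈ J^{[q]} to the p-th power makes (ν(q)+1)/q decrease. -/

theorem frobPow_eq_map (I : Ideal R) (e : ℕ) :
    frobPow I (p ^ e) = I.map (iterateFrobenius R p e) := rfl

theorem frobPow_frobPow (I : Ideal R) (e k : ℕ) :
    frobPow (frobPow I (p ^ e)) (p ^ k) = frobPow I (p ^ (e + k)) := by
  simp only [frobPow_eq_map, Ideal.map_map]
  congr 1
  ext x
  simp only [RingHom.comp_apply, iterateFrobenius_def]
  rw [← pow_mul, ← pow_add]

theorem frobPow_mono {I J : Ideal R} (h : I ≤ J) (q : ℕ) : frobPow I q ≤ frobPow J q :=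
  Ideal.span_mono (Set.image_mono h)

theorem pow_mem_frobPow_self {I : Ideal R} {x : R} (hx : x ∈ I) (q : ℕ) :
    x ^ q ∈ frobPow I q :=
  Ideal.subset_span ⟨x, hx, rfl⟩

theorem frobPow_one (I : Ideal R) : frobPow I 1 = I := by
  simp [frobPow]

theorem frobClosure_le_tightClosure (I : Ideal R) : frobClosure p I ≤ tightClosure p I := by
  rintro x ⟨e₀, hx⟩
  exact ⟨1, one_mem_circ R, e₀, fun e he => by
    simpa using pow_mem_frobPow p he hx⟩

theorem le_frobClosure (I : Ideal R) : I ≤ frobClosure p I := fun _ hx =>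
  ⟨0, pow_mem_frobPow_self hx _⟩

theorem le_tightClosure (J : Ideal R) : J ≤ tightClosure p J :=
  (le_frobClosure p J).trans (frobClosure_le_tightClosure p J)

theorem frobPow_tightClosure_le (J : Ideal R) (e : ℕ) :
    frobPow (tightClosure p J) (p ^ e) ≤ tightClosure p (frobPow J (p ^ e)) := by
  refine Ideal.span_le.2 ?_
  rintro _ ⟨x, ⟨c, hc, e₀, hx⟩, rfl⟩
  refine ⟨c, hc, e₀, fun k hk => ?_⟩
  have h := hx (e + k) (by omega)
  rwa [frobPow_frobPow, ← pow_mul, ← pow_add]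

/-- If `c x^q ∈ I^{[q]}` then `c ⊗ x̄ = 0` in `ᵉR ⊗ R/I`. -/
theorem smul_frobMap_mk_eq_zero {I : Ideal R} {c x : R} {e : ℕ}
    (h : c * x ^ p ^ e ∈ frobPow I (p ^ e)) :
    FrobRing.of R p e c • frobMap R p e (R ⧸ I) (Ideal.Quotient.mk I x) = 0 := by
  -- A scalar z crosses the tensor sign as z^q, because R acts on the left factor through Frobenius.
  have key : ∀ b z : R, (FrobRing.of R p e b) ⊗ₜ[R] (Ideal.Quotient.mk I z) =
      (FrobRing.of R p e (b * z ^ p ^ e)) ⊗ₜ[R] (Ideal.Quotient.mk I 1) := by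
    intro b z
    have h1 : Ideal.Quotient.mk I z = z • Ideal.Quotient.mk I 1 := by
      rw [← Ideal.Quotient.mk_eq_mk, ← Ideal.Quotient.mk_eq_mk, ← Submodule.Quotient.mk_smul,
        smul_eq_mul, mul_one]
    rw [h1, ← TensorProduct.smul_tmul]
    congr 1
    rw [Algebra.smul_def, mul_comm, map_mul]
    rfl
  have van : ∀ y ∈ frobPow I (p ^ e),
      (FrobRing.of R p e y) ⊗ₜ[R] (Ideal.Quotient.mk I 1) = 0 := by
    intro y hy
    refine Submodule.span_induction (p := fun y _ =>
      (FrobRing.of R p e y) ⊗ₜ[R] (Ideal.Quotient.mk I 1) = 0) ?_ ?_ ?_ ?_ hy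
    · rintro _ ⟨z, hz, rfl⟩
      have := key 1 z
      rw [one_mul, Ideal.Quotient.eq_zero_iff_mem.2 hz, TensorProduct.tmul_zero] at this
      exact this.symm
    · rw [map_zero, TensorProduct.zero_tmul]
    · intro s t _ _ hs ht
      rw [map_add, TensorProduct.add_tmul, hs, ht, add_zero]
    · intro b s _ hs
      have h2 : (FrobRing.of R p e (b • s)) ⊗ₜ[R] (Ideal.Quotient.mk I 1) =
          (FrobRing.of R p e b) • ((FrobRing.of R p e s) ⊗ₜ[R] (Ideal.Quotient.mk I 1)) := by
        rw [TensorProduct.smul_tmul', smul_eq_mul, smul_eq_mul, map_mul]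
      rw [h2, hs, smul_zero]
  have h3 : FrobRing.of R p e c • frobMap R p e (R ⧸ I) (Ideal.Quotient.mk I x) =
      (FrobRing.of R p e c) ⊗ₜ[R] (Ideal.Quotient.mk I x) := by
    rw [frobMap, TensorProduct.mk_apply, TensorProduct.smul_tmul', smul_eq_mul, mul_one]
  rw [h3, key, van _ h]

/-- Take M = R/I in the definition of τ(R): the class of an element of I^* lies in 0^*_M. -/
theorem testIdeal_mul_tightClosure_le (I : Ideal R) :
    testIdeal R p * tightClosure p I ≤ I := by
  refine Ideal.mul_le.2 fun t ht x hx => ?_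
  obtain ⟨c, hc, e₀, h⟩ := hx
  have hz : (Ideal.Quotient.mk I x) ∈ tightClosureModule p (⊥ : Submodule R (R ⧸ I)) :=
    ⟨c, hc, e₀, fun e he => by
      rw [smul_frobMap_mk_eq_zero p (h e he)]
      exact Submodule.zero_mem _⟩
  have ht' : t ∈ (tightClosureModule p (⊥ : Submodule R (R ⧸ I))).annihilator := by
    simp only [testIdeal, Submodule.mem_iInf] at ht
    exact ht (R ⧸ I) _ _ inferInstance
  have h0 := Submodule.mem_annihilator.1 ht' _ hz
  exact Ideal.Quotient.eq_zero_iff_mem.1 h0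

variable {p}

/-- Purity is tested on the cyclic module R/I, where the hypothesis says that 1 ⊗ x̄ = 0. -/
theorem IsFPure.mem_of_pow_mem (h : IsFPure R p) {I : Ideal R} {x : R}
    (hx : x ^ p ∈ frobPow I p) : x ∈ I := by
  have h1 := smul_frobMap_mk_eq_zero p (I := I) (c := 1) (x := x) (e := 1) (by simpa using hx)
  rw [map_one, one_smul] at h1
  exact Ideal.Quotient.eq_zero_iff_mem.1 (h (R ⧸ I) (h1.trans (map_zero _).symm))

theorem IsFPure.frobClosure_eq (h : IsFPure R p) (I : Ideal R) : frobClosure p I = I := by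
  refine le_antisymm ?_ (le_frobClosure p I)
  rintro x ⟨e, hx⟩
  induction e with
  | zero => simpa [frobPow_one] using hx
  | succ e ih =>
    refine ih (h.mem_of_pow_mem ?_)
    have h2 := frobPow_frobPow p I e 1
    rw [pow_one] at h2
    rwa [h2, ← pow_mul, ← pow_succ]

end Algebra

/-! ### Bounds on ν -/

section Nu

variable {R : Type u} [CommRing R]

theorem le_nu {a J : Ideal R} {q : ℕ} (hb : BddAbove {r : ℕ | ¬ a ^ r ≤ frobPow J q}) {r : ℕ}
    (h : ¬ a ^ r ≤ frobPow J q) : r ≤ nu a J q :=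
  le_csSup hb h

theorem pow_le_of_nu_lt {a J : Ideal R} {q : ℕ}
    (hb : BddAbove {r : ℕ | ¬ a ^ r ≤ frobPow J q}) {r : ℕ} (h : nu a J q < r) :
    a ^ r ≤ frobPow J q := by
  by_contra h'
  exact absurd (le_nu hb h') (not_le.2 h)

theorem nu_le {a J : Ideal R} {q n : ℕ} (h : ∀ r, ¬ a ^ r ≤ frobPow J q → r ≤ n) :
    nu a J q ≤ n := by
  rcases Set.eq_empty_or_nonempty {r : ℕ | ¬ a ^ r ≤ frobPow J q} with h0 | h0
  · simp [nu, h0]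
  · exact csSup_le h0 h

/-- The value 0 is excluded because it is also the default for an empty set, as when J is the unit
ideal. -/
theorem not_pow_nu_le {a J : Ideal R} {q : ℕ}
    (hb : BddAbove {r : ℕ | ¬ a ^ r ≤ frobPow J q}) (h0 : nu a J q ≠ 0) :
    ¬ a ^ nu a J q ≤ frobPow J q := by
  rcases Set.eq_empty_or_nonempty {r : ℕ | ¬ a ^ r ≤ frobPow J q} with h1 | h1
  · exact absurd (by simp [nu, h1]) h0
  · exact Nat.sSup_mem h1 hb

theorem nu_le_of_pow_le {a J : Ideal R} {q n : ℕ} (h : a ^ n ≤ frobPow J q) :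
    nu a J q ≤ n :=
  nu_le fun _ hr => le_of_not_ge fun hn => hr ((Ideal.pow_le_pow_right hn).trans h)

theorem bddAbove_of_pow_le {a J : Ideal R} {q n : ℕ} (h : a ^ n ≤ frobPow J q) :
    BddAbove {r : ℕ | ¬ a ^ r ≤ frobPow J q} :=
  ⟨n, fun _ hr => le_of_not_ge fun hn => hr ((Ideal.pow_le_pow_right hn).trans h)⟩

/-- A pigeonhole on exponents, one generator at a time. The bound is not sharp; only its linearity
in q matters. -/
theorem span_finset_pow_le_frobPow {I : Ideal R} {q : ℕ} (hq : q ≠ 0) (s : Finset R)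
    (hs : ∀ x ∈ s, x ∈ I) : Ideal.span (s : Set R) ^ ((s.card + 1) * q) ≤ frobPow I q := by
  classical
  induction s using Finset.induction_on with
  | empty => simp [Ideal.bot_pow hq]
  | insert x s hx ih =>
    have h1 : x ^ q ∈ frobPow I q := pow_mem_frobPow_self (hs x (Finset.mem_insert_self x s)) q
    rw [Finset.card_insert_of_notMem hx, add_mul, one_mul, add_comm, Finset.coe_insert,
      Ideal.span_insert]
    refine Ideal.sup_pow_add_le_pow_sup_pow.trans (sup_le ?_ ?_)
    · rwa [Ideal.span_singleton_pow, Ideal.span_singleton_le_iff_mem]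
    · exact ih fun y hy => hs y (Finset.mem_insert_of_mem hy)

theorem exists_pow_mul_le_frobPow [IsNoetherianRing R] {a J : Ideal R} (haJ : a ≤ J.radical) :
    ∃ B : ℕ, ∀ q : ℕ, q ≠ 0 → a ^ (B * q) ≤ frobPow J q := by
  obtain ⟨N, hN⟩ := Ideal.exists_pow_le_of_le_radical_of_fg haJ (IsNoetherian.noetherian a)
  obtain ⟨s, hs⟩ := IsNoetherian.noetherian (a ^ N)
  refine ⟨N * (s.card + 1), fun q hq => ?_⟩
  rw [mul_assoc, pow_mul, ← hs]
  exact span_finset_pow_le_frobPow hq s fun x hx => hN (hs ▸ Ideal.subset_span hx)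

end Nu

/-! ### Convergence of almost monotone sequences -/

section Limits

theorem hasFThreshold_of_tendsto {R : Type u} [CommRing R] {p : ℕ} (hp : p ≠ 0) {a J : Ideal R}
    {c : ℝ≥0} (h : Tendsto (fun e : ℕ => (nu a J (p ^ e) : ℝ) / (p : ℝ) ^ e) atTop (𝓝 (c : ℝ))) :
    HasFThreshold p a J c := by
  have h1 : Tendsto (fun e : ℕ => (nu a J (p ^ e) : ℝ≥0∞) / ((p ^ e : ℕ) : ℝ≥0∞)) atTop
      (𝓝 (c : ℝ≥0∞)) := by
    have h2 := ENNReal.tendsto_ofReal h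
    rw [ENNReal.ofReal_coe_nnreal] at h2
    refine h2.congr fun e => ?_
    have : (0 : ℝ) < (p : ℝ) ^ e := by positivity
    rw [ENNReal.ofReal_div_of_pos this, ENNReal.ofReal_natCast, ← Nat.cast_pow,
      ENNReal.ofReal_natCast]
  exact ⟨h1.limsup_eq, h1.liminf_eq⟩

theorem tendsto_const_div_pow {p : ℕ} (hp : 1 < p) (C : ℝ) :
    Tendsto (fun e : ℕ => C / (p : ℝ) ^ e) atTop (𝓝 0) :=
  tendsto_const_nhds.div_atTop (tendsto_pow_atTop_atTop_of_one_lt (by exact_mod_cast hp))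

theorem exists_tendsto_of_superadditive {p : ℕ} (hp : 1 < p) {v : ℕ → ℕ} {B d e₀ : ℕ}
    (hB : ∀ e, v e ≤ B * p ^ e) (h : ∀ e ≥ e₀, p * (v e - d) ≤ v (e + 1)) :
    ∃ c : ℝ≥0, Tendsto (fun e : ℕ => (v e : ℝ) / (p : ℝ) ^ e) atTop (𝓝 (c : ℝ)) := by
  have hp' : (2 : ℝ) ≤ p := by exact_mod_cast hp
  -- Shifting by 2d absorbs the loss pd at each step, since pd ≤ 2d(p-1) for p ≥ 2.
  set w : ℕ → ℝ := fun e => ((v (e + e₀) : ℝ) - 2 * d) / (p : ℝ) ^ (e + e₀) with hw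
  have hpos : ∀ e : ℕ, (0 : ℝ) < (p : ℝ) ^ e := fun e => by positivity
  have hmono : Monotone w := by
    refine monotone_nat_of_le_succ fun e => ?_
    have h1 : (p : ℝ) * (v (e + e₀) - d) ≤ v (e + e₀ + 1) := by
      have h2 : ((p * (v (e + e₀) - d) : ℕ) : ℝ) ≤ v (e + e₀ + 1) := by
        exact_mod_cast h (e + e₀) (by omega)
      have h3 : (v (e + e₀) : ℝ) ≤ ((v (e + e₀) - d : ℕ) : ℝ) + d := by
        exact_mod_cast (by omega : v (e + e₀) ≤ v (e + e₀) - d + d)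
      push_cast at h2
      nlinarith
    simp only [hw]
    rw [show e + 1 + e₀ = e + e₀ + 1 by ring, div_le_div_iff₀ (hpos _) (hpos _), pow_succ]
    have hd : (0 : ℝ) ≤ d := Nat.cast_nonneg d
    have h4 : (p : ℝ) * (v (e + e₀) - 2 * d) ≤ v (e + e₀ + 1) - 2 * d := by nlinarith
    nlinarith [mul_le_mul_of_nonneg_right h4 (hpos (e + e₀)).le]
  have hbdd : BddAbove (Set.range w) := by
    refine ⟨B, ?_⟩
    rintro _ ⟨e, rfl⟩
    have h1 : (v (e + e₀) : ℝ) ≤ B * (p : ℝ) ^ (e + e₀) := by exact_mod_cast hB (e + e₀)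
    simp only [hw]
    rw [div_le_iff₀ (hpos _)]
    have hd : (0 : ℝ) ≤ d := Nat.cast_nonneg d
    linarith
  have h1 : Tendsto (fun e : ℕ => ((v e : ℝ) - 2 * d) / (p : ℝ) ^ e) atTop (𝓝 (⨆ i, w i)) :=
    (tendsto_add_atTop_iff_nat e₀).1 (tendsto_atTop_ciSup hmono hbdd)
  have h2 : Tendsto (fun e : ℕ => (v e : ℝ) / (p : ℝ) ^ e) atTop (𝓝 (⨆ i, w i)) := by
    have h3 := h1.add (tendsto_const_div_pow hp (2 * d))
    rw [add_zero] at h3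
    refine h3.congr fun e => ?_
    rw [← add_div, sub_add_cancel]
  have h0 : 0 ≤ ⨆ i, w i := ge_of_tendsto' h2 fun e => by positivity
  exact ⟨⟨_, h0⟩, h2⟩

theorem exists_tendsto_of_subadditive {p : ℕ} (hp : 1 < p) {v : ℕ → ℕ}
    (h : ∀ e, v (e + 1) + 1 ≤ p * (v e + 1)) :
    ∃ c : ℝ≥0, Tendsto (fun e : ℕ => (v e : ℝ) / (p : ℝ) ^ e) atTop (𝓝 (c : ℝ)) := by
  set w : ℕ → ℝ := fun e => ((v e : ℝ) + 1) / (p : ℝ) ^ e with hw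
  have hpos : ∀ e : ℕ, (0 : ℝ) < (p : ℝ) ^ e := fun e => by positivity
  have hanti : Antitone w := by
    refine antitone_nat_of_succ_le fun e => ?_
    have h1 : (v (e + 1) : ℝ) + 1 ≤ p * (v e + 1) := by exact_mod_cast h e
    simp only [hw]
    rw [div_le_div_iff₀ (hpos _) (hpos _), pow_succ]
    nlinarith [mul_le_mul_of_nonneg_right h1 (hpos e).le]
  have hbdd : BddBelow (Set.range w) := by
    refine ⟨0, ?_⟩
    rintro _ ⟨e, rfl⟩
    positivity
  have h2 : Tendsto (fun e : ℕ => (v e : ℝ) / (p : ℝ) ^ e) atTop (𝓝 (⨅ i, w i)) := by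
    have h3 := (tendsto_atTop_ciInf hanti hbdd).sub (tendsto_const_div_pow hp 1)
    rw [sub_zero] at h3
    refine h3.congr fun e => ?_
    simp only [hw]
    rw [← sub_div, add_sub_cancel_right]
  have h0 : 0 ≤ ⨅ i, w i := ge_of_tendsto' h2 fun e => by positivity
  exact ⟨⟨_, h0⟩, h2⟩

end Limits

/-! ### Existence and comparison of F-thresholds -/

section Thresholds

variable {R : Type u} [CommRing R] [IsNoetherianRing R] {p : ℕ} [Fact p.Prime] [CharP R p]

theorem exists_tendsto_of_pow_mul_frobClosure_le {a J : Ideal R} (haJ : a ≤ J.radical) {d e₀ : ℕ}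
    (h : ∀ e ≥ e₀, a ^ d * frobClosure p (frobPow J (p ^ e)) ≤ frobPow J (p ^ e)) :
    ∃ c : ℝ≥0, Tendsto (fun e : ℕ => (nu a J (p ^ e) : ℝ) / (p : ℝ) ^ e) atTop (𝓝 (c : ℝ)) := by
  have hp : p.Prime := Fact.out
  obtain ⟨B, hB⟩ := exists_pow_mul_le_frobPow haJ
  have hB' := fun e : ℕ => hB (p ^ e) (pow_ne_zero e hp.ne_zero)
  refine exists_tendsto_of_superadditive hp.one_lt (B := B) (d := d) (e₀ := e₀)
    (fun e => nu_le_of_pow_le (hB' e)) fun e he => ?_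
  -- For ν ≤ d the truncated difference is 0 and nothing is to be proved.
  rcases le_or_gt (nu a J (p ^ e)) d with hd | hd
  · simp [Nat.sub_eq_zero_of_le hd]
  refine le_nu (bddAbove_of_pow_le (hB' _)) fun hle => ?_
  refine not_pow_nu_le (bddAbove_of_pow_le (hB' e)) (by omega) ?_
  rw [← Nat.add_sub_of_le hd.le, pow_add]
  refine (Ideal.mul_mono_right fun x hx => ?_).trans (h e he)
  refine ⟨1, ?_⟩
  rw [frobPow_frobPow]
  apply hle
  rw [pow_one, mul_comm, pow_mul]
  exact Ideal.pow_mem_pow hx p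

/-- A power of a principal ideal is tested on the single element f^n, so containments pass from q to
pq without loss. -/
theorem exists_tendsto_of_isPrincipal {a J : Ideal R} (haJ : a ≤ J.radical)
    (ha : a.IsPrincipal) :
    ∃ c : ℝ≥0, Tendsto (fun e : ℕ => (nu a J (p ^ e) : ℝ) / (p : ℝ) ^ e) atTop (𝓝 (c : ℝ)) := by
  have hp : p.Prime := Fact.out
  obtain ⟨f, rfl⟩ := ha
  obtain ⟨B, hB⟩ := exists_pow_mul_le_frobPow haJ
  have hB' := fun e : ℕ => hB (p ^ e) (pow_ne_zero e hp.ne_zero)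
  refine exists_tendsto_of_subadditive hp.one_lt fun e => ?_
  set n := nu (Submodule.span R {f}) J (p ^ e) with hn
  have h1 : (Ideal.span {f}) ^ (n + 1) ≤ frobPow J (p ^ e) :=
    pow_le_of_nu_lt (bddAbove_of_pow_le (hB' e)) (Nat.lt_succ_self _)
  rw [Ideal.span_singleton_pow, Ideal.span_singleton_le_iff_mem] at h1
  have h2 : (Ideal.span {f}) ^ (p * (n + 1)) ≤ frobPow J (p ^ (e + 1)) := by
    rw [Ideal.span_singleton_pow, Ideal.span_singleton_le_iff_mem, mul_comm, pow_mul,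
      ← frobPow_frobPow, pow_one]
    exact pow_mem_frobPow_self h1 p
  have h3 : p * (n + 1) ≠ 0 := mul_ne_zero hp.ne_zero (Nat.succ_ne_zero n)
  have h4 : nu (Ideal.span {f}) J (p ^ (e + 1)) ≤ p * (n + 1) - 1 :=
    nu_le fun r hr => by
      by_contra hlt
      exact hr ((Ideal.pow_le_pow_right (by omega)).trans h2)
  change nu (Ideal.span {f}) J (p ^ (e + 1)) + 1 ≤ _
  omega

/-- A squeeze: (J^*)^{[q]} lies between J^{[q]} and (J^{[q]})^*, and a^d multiplies the latter back
into J^{[q]}. -/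
theorem tendsto_nu_tightClosure {a J : Ideal R} (haJ : a ≤ J.radical) {d : ℕ}
    (hd : a ^ d ≤ testIdeal R p) {c : ℝ}
    (hc : Tendsto (fun e : ℕ => (nu a J (p ^ e) : ℝ) / (p : ℝ) ^ e) atTop (𝓝 c)) :
    Tendsto (fun e : ℕ => (nu a (tightClosure p J) (p ^ e) : ℝ) / (p : ℝ) ^ e) atTop (𝓝 c) := by
  have hp : p.Prime := Fact.out
  obtain ⟨B, hB⟩ := exists_pow_mul_le_frobPow haJ
  have hB' := fun e : ℕ => hB (p ^ e) (pow_ne_zero e hp.ne_zero)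
  have hle : ∀ e, frobPow J (p ^ e) ≤ frobPow (tightClosure p J) (p ^ e) := fun e =>
    frobPow_mono (le_tightClosure p J) _
  have h1 : ∀ e, nu a (tightClosure p J) (p ^ e) ≤ nu a J (p ^ e) := fun e =>
    nu_le fun r hr => le_nu (bddAbove_of_pow_le (hB' e)) fun h => hr (h.trans (hle e))
  have h2 : ∀ e, nu a J (p ^ e) ≤ nu a (tightClosure p J) (p ^ e) + 1 + d := fun e => by
    refine nu_le_of_pow_le ?_
    rw [add_comm, pow_add]
    refine (Ideal.mul_mono hd ?_).trans (testIdeal_mul_tightClosure_le p _)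
    exact (pow_le_of_nu_lt (bddAbove_of_pow_le ((hB' e).trans (hle e)))
      (Nat.lt_succ_self _)).trans (frobPow_tightClosure_le p J e)
  have h3 := hc.sub (tendsto_const_div_pow hp.one_lt (1 + d))
  rw [sub_zero] at h3
  have hpos : ∀ e : ℕ, (0 : ℝ) < (p : ℝ) ^ e := fun e =>
    pow_pos (by exact_mod_cast hp.pos) e
  refine tendsto_of_tendsto_of_tendsto_of_le_of_le h3 hc (fun e => ?_) fun e => ?_
  · have : (nu a J (p ^ e) : ℝ) ≤ nu a (tightClosure p J) (p ^ e) + 1 + d := by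
      exact_mod_cast h2 e
    simp only [← sub_div]
    exact div_le_div_of_nonneg_right (by linarith) (hpos e).le
  · exact div_le_div_of_nonneg_right (Nat.cast_le.2 (h1 e)) (hpos e).le

end Thresholds

end FThreshold

theorem lemma2p3 {R : Type u} [CommRing R] [IsNoetherianRing R] (p : ℕ) [Fact p.Prime] [CharP R p]
    (a J : Ideal R) (ha : a ≠ ⊤) (ha' : ((a : Set R) ∩ FThreshold.circ R).Nonempty)
    (haJ : a ≤ J.radical) :
    ((∃ e₀ : ℕ, ∀ e ≥ e₀,
        FThreshold.frobPow J (p ^ e) = FThreshold.frobClosure p (FThreshold.frobPow J (p ^ e))) →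
      ∃ c : ℝ≥0, FThreshold.HasFThreshold p a J c) ∧
    (FThreshold.IsFPure R p → ∃ c : ℝ≥0, FThreshold.HasFThreshold p a J c) ∧
    (a ≤ (FThreshold.testIdeal R p).radical →
      ∃ c : ℝ≥0, FThreshold.HasFThreshold p a J c ∧
        FThreshold.HasFThreshold p a (FThreshold.tightClosure p J) c) ∧
    (a.IsPrincipal → ∃ c : ℝ≥0, FThreshold.HasFThreshold p a J c) := by
  have hp : p ≠ 0 := (Fact.out : p.Prime).ne_zero
  have closed : (∃ e₀ : ℕ, ∀ e ≥ e₀,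
        FThreshold.frobPow J (p ^ e) = FThreshold.frobClosure p (FThreshold.frobPow J (p ^ e))) →
      ∃ c : ℝ≥0, FThreshold.HasFThreshold p a J c := by
    rintro ⟨e₀, h⟩
    obtain ⟨c, hc⟩ := FThreshold.exists_tendsto_of_pow_mul_frobClosure_le (p := p) haJ (d := 0)
      (e₀ := e₀) fun e he => by rw [← h e he]; exact Ideal.mul_le_right (I := a ^ 0) (J := FThreshold.frobPow J (p ^ e))
    exact ⟨c, FThreshold.hasFThreshold_of_tendsto hp hc⟩
  refine ⟨closed, fun hF => closed ⟨0, fun e _ => (hF.frobClosure_eq _).symm⟩, fun hτ => ?_,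
    fun hP => ?_⟩
  · obtain ⟨d, hd⟩ := Ideal.exists_pow_le_of_le_radical_of_fg hτ (IsNoetherian.noetherian a)
    obtain ⟨c, hc⟩ := FThreshold.exists_tendsto_of_pow_mul_frobClosure_le (p := p) haJ (d := d)
      (e₀ := 0) fun e _ =>
        (Ideal.mul_mono hd (FThreshold.frobClosure_le_tightClosure p _)).trans
          (FThreshold.testIdeal_mul_tightClosure_le p _)
    exact ⟨c, FThreshold.hasFThreshold_of_tendsto hp hc,
      FThreshold.hasFThreshold_of_tendsto hp (FThreshold.tendsto_nu_tightClosure haJ hd hc)⟩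
  · obtain ⟨c, hc⟩ := FThreshold.exists_tendsto_of_isPrincipal (p := p) haJ hP
    exact ⟨c, FThreshold.hasFThreshold_of_tendsto hp hc⟩
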